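/- All graphs are finite and simple. A $(k_1,k_2)$-coloring of a graph is a partition of its vertex set into two classes, the first inducing a subgraph of maximum degree at most $k_1$ and the second inducing a subgraph of maximum degree at most $k_2$; for $k_1=0$ the vertices of the first class are said to be colored $0$. A graph is $(C_3,C_4,C_6)$-free if it contains no cycle of length $3$, $4$ or $6$. **The gadget $F_{x,y}$.** Its vertices are two terminals $x,y$ and the following vertices, where $1\le i\le 4$ and $1\le j\le 3$. On the side of $x$: white vertices $w_i$, big vertices $p_i$, and green vertices $u_i,g_i$. On the side of $y$: white vertices $w'_i$, big vertices $p'_i$, and green vertices $u'_i,g'_i$. Moreover there are nine pairs of adjacent red vertices, three for each $j$. The edges are $xw_i,\ w_ip_i,\ xu_i,\ u_ig_i,\ g_ip_i$; symmetrically $yw'_i,\ w'_ip'_i,\ yu'_i,\ u'_ig'_i,\ g'_ip'_i$; the edges $p_ip'_i$; and, for each $j$, the edges of three paths of length $3$ joining $p_j$ to $p_{j+1}$, $p'_j$ to $p'_{j+1}$, and $p_j$ to $p'_{j+1}$, respectively, the two interior vertices of each path being one of the red pairs. **The graph $G$.** Take two disjoint edges $ab$ and $cd$, and for each of the four pairs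 $(x,y)\in\{a,b\}\times\{c,d\}$ add seven copies of $F_{x,y}$; distinct copies share no vertices other than terminals. **The green parts.** The green part of $F_{x,y}$ consists of the vertices $u_i,g_i,u'_i,g'_i$. The green part of $G$ consists of all non-terminal vertices of two of the seven copies for each pair $(x,y)$, together with the green parts of the remaining copies. Let $F^-_{x,y}$ and $G^-$ be the graphs obtained from $F_{x,y}$ and $G$ by deleting the green vertices. Then: 1. In every $(0,3)$-coloring of $F_{x,y}$, some neighbor of $x$ or of $y$ is not colored $0$. 2. $G$ is a $(C_3,C_4,C_6)$-free planar graph, and $G$ is not $(0,3)$-colorable. 3. In every $(0,2)$-coloring of $F^-_{x,y}$, some neighbor of $x$ or of $y$ is not colored $0$. 4. $G^-$ is a planar graph of girth $7$ on $684$ vertices, and $G^-$ is not $(0,2)$-colorable. -/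

import Mathlib

/-- The set `A` is the first class of a `(k₁, k₂)`-coloring of `G`: the subgraph induced by `A` has
maximum degree at most `k₁`, the subgraph induced by the complement of `A` has maximum degree at
most `k₂`. For `k₁ = 0` the vertices of `A` are those "colored `0`". -/
def IsDefectiveColoring {V : Type*} (G : SimpleGraph V) (k₁ k₂ : ℕ) (A : Set V) : Prop :=
  (∀ v ∈ A, (G.neighborSet v ∩ A).encard ≤ k₁) ∧
    (∀ v ∈ Aᶜ, (G.neighborSet v ∩ Aᶜ).encard ≤ k₂)

/-- `G` is `(k₁, k₂)`-colorable. -/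
def IsDefectiveColorable {V : Type*} (G : SimpleGraph V) (k₁ k₂ : ℕ) : Prop :=
  ∃ A : Set V, IsDefectiveColoring G k₁ k₂ A

/-- `A` is a simple arc in the plane with end points `p` and `q`. -/
def IsPlaneArc (A : Set (ℝ × ℝ)) (p q : ℝ × ℝ) : Prop :=
  ∃ γ : unitInterval → ℝ × ℝ,
    Continuous γ ∧ Function.Injective γ ∧ γ 0 = p ∧ γ 1 = q ∧ Set.range γ = A

/-- `G` can be drawn in the plane: the vertices are distinct points, every edge is a simple arc
that joins its two ends and meets no other vertex, and two distinct edges meet at most in the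
images of their common ends. -/
def IsPlanarGraph {V : Type*} (G : SimpleGraph V) : Prop :=
  ∃ (pos : V → ℝ × ℝ) (arc : Sym2 V → Set (ℝ × ℝ)),
    Function.Injective pos ∧
    (∀ u v, G.Adj u v → IsPlaneArc (arc s(u, v)) (pos u) (pos v)) ∧
    (∀ e ∈ G.edgeSet, ∀ w, pos w ∈ arc e → w ∈ e) ∧
    (∀ e ∈ G.edgeSet, ∀ f ∈ G.edgeSet, e ≠ f →
      arc e ∩ arc f ⊆ pos '' {w | w ∈ e ∧ w ∈ f})

/-- The class of `(C₃, C₄, C₆)`-free planar graphs. -/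
def InClassC {V : Type*} (G : SimpleGraph V) : Prop :=
  IsPlanarGraph G ∧ (SimpleGraph.cycleGraph 3).Free G ∧ (SimpleGraph.cycleGraph 4).Free G ∧
    (SimpleGraph.cycleGraph 6).Free G

/-- The vertices of the forcing gadget other than its terminals. A first argument `s : Bool` says
on which side the vertex lies: `false` for the side of `x`, `true` for the side of `y`. -/
inductive GadgetInner : Type
  /-- white neighbours of the terminals -/
  | white (s : Bool) (i : Fin 4)
  /-- the eight big vertices -/
  | big (s : Bool) (i : Fin 4)
  /-- the red vertices: `red j m false` and `red j m true` form the pair number `m` of three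
  pairs between the levels `j` and `j + 1` -/
  | red (j : Fin 3) (m : Fin 3) (e : Bool)
  /-- green neighbours of the terminals (also white in the sense of the coloring argument) -/
  | greenWhite (s : Bool) (i : Fin 4)
  /-- green neighbours of the big vertices -/
  | greenNbr (s : Bool) (i : Fin 4)
  deriving DecidableEq, Fintype

/-- The vertices of the forcing gadget `F_{x,y}`. -/
inductive GadgetVertex : Type
  /-- `terminal false` is `x` and `terminal true` is `y` -/
  | terminal (s : Bool)
  | inner (v : GadgetInner)
  deriving DecidableEq, Fintype

/-- The big vertex `(side, level)` to which the red vertex `red j m e` is attached. The pair `0`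
joins the big vertices of levels `j` and `j + 1` on the side of `x`, the pair `1` those on the side
of `y`, and the pair `2` joins level `j` on the side of `x` to level `j + 1` on the side of `y`. -/
def redEnd (j : Fin 3) (m : Fin 3) (e : Bool) : Bool × Fin 4 :=
  (if m = 0 then false else if m = 1 then true else e, if e then j.succ else j.castSucc)

/-- The edges of the gadget, each in at least one direction. -/
def gadgetRel : GadgetVertex → GadgetVertex → Prop
  | .terminal s, .inner (.white t _) => s = t
  | .inner (.white s i), .inner (.big t j) => s = t ∧ i = j
  | .inner (.big s i), .inner (.big t j) => s ≠ t ∧ i = j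
  | .inner (.big s i), .inner (.red j m e) => (s, i) = redEnd j m e
  | .inner (.red j m e), .inner (.red j' m' e') => j = j' ∧ m = m' ∧ e ≠ e'
  | .terminal s, .inner (.greenWhite t _) => s = t
  | .inner (.greenWhite s i), .inner (.greenNbr t j) => s = t ∧ i = j
  | .inner (.greenNbr s i), .inner (.big t j) => s = t ∧ i = j
  | _, _ => False

/-- The forcing gadget `F_{x,y}`. -/
def forcingGadget : SimpleGraph GadgetVertex := SimpleGraph.fromRel gadgetRel

/-- The vertices of the green part of the gadget. -/
def GadgetVertex.IsGreen : GadgetVertex → Prop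
  | .inner (.greenWhite _ _) => True
  | .inner (.greenNbr _ _) => True
  | _ => False

/-- The vertices of the full construction: the four ends `hub e p` of the two drawn edges (`e` is
the edge, `p` the end), and for every end `p` of the first edge and every end `q` of the second one
the inner vertices of seven copies of the gadget. -/
inductive FullVertex : Type
  | hub (e p : Bool)
  | copy (p q : Bool) (c : Fin 7) (v : GadgetInner)
  deriving DecidableEq, Fintype

/-- The position in the full construction of the vertices of the copy number `c` that links the
end `p` of the first edge to the end `q` of the second edge. -/
def placeCopy (p q : Bool) (c : Fin 7) : GadgetVertex → FullVertex
  | .terminal false => .hub false p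
  | .terminal true => .hub true q
  | .inner v => .copy p q c v

/-- The full construction: two disjoint edges, and seven copies of the gadget between each end of
the first edge and each end of the second edge. -/
def fullGraph : SimpleGraph FullVertex :=
  SimpleGraph.fromRel fun u v =>
    (∃ e, u = .hub e false ∧ v = .hub e true) ∨
    (∃ p q c a b, forcingGadget.Adj a b ∧ u = placeCopy p q c a ∧ v = placeCopy p q c b)

/-- The green part of the full construction: two of the seven copies in each bundle, and the green
part of each of the other copies. -/
def FullVertex.IsGreen : FullVertex → Prop
  | .hub _ _ => False
  | .copy _ _ c v => 5 ≤ c ∨ (GadgetVertex.inner v).IsGreen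

/-- The gadget without its green part. -/
def reducedGadget : SimpleGraph {v : GadgetVertex // ¬ v.IsGreen} :=
  forcingGadget.induce {v : GadgetVertex | ¬ v.IsGreen}

/-- The full construction without its green part. -/
def reducedGraph : SimpleGraph {v : FullVertex // ¬ v.IsGreen} :=
  fullGraph.induce {v : FullVertex | ¬ v.IsGreen}

/-!
If all neighbors of both terminals of the gadget are colored `0`, then no big vertex is colored `0`,
and every red pair has a vertex that is not colored `0`. There are nine red pairs and eight big
vertices, so some big vertex has two such red neighbors, besides its opposite big vertex and, if the
green part is present, a green neighbor: too many for a second class of maximum degree `3`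
(respectively `2`). In the full construction each drawn edge has an end that is not colored `0`; the
seven (respectively five) copies between two such ends supply more than `2 * 3` (respectively
`2 * 2`) further neighbors outside the first class to these two vertices.

The terminals of a copy have distance at least `5`, so a cycle of length less than `10` misses a
terminal of every copy. The other terminal then separates the copy from the rest of the cycle, so
that the cycle stays within one copy, where the cycles of length at most `6` can be enumerated.

For the drawing, the gadget is drawn with straight segments in a strip whose vertical sides stand
for the terminals; the copies are stacked on top of each other and the sides are shrunk to points.
-/

/-! ### Defective colorings -/

section DefectiveColoring

variable {V W : Type*} {G : SimpleGraph V} {H : SimpleGraph W} {k₁ k₂ k : ℕ}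

theorem IsDefectiveColoring.isIndepSet {A : Set V} (hA : IsDefectiveColoring G 0 k A) :
    G.IsIndepSet A := by
  intro u hu v hv _ huv
  have hempty : G.neighborSet u ∩ A = ∅ := by simpa using hA.1 u hu
  exact hempty.subset ⟨huv, hv⟩

theorem IsDefectiveColoring.notMem_of_adj {A : Set V} (hA : IsDefectiveColoring G 0 k A)
    {u v : V} (huv : G.Adj u v) (hu : u ∈ A) : v ∉ A :=
  fun hv => hA.isIndepSet hu hv huv.ne huv

theorem IsDefectiveColoring.card_le {A : Set V} (hA : IsDefectiveColoring G k₁ k₂ A) {v : V}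
    (hv : v ∉ A) (s : Finset V) (hs : ∀ u ∈ s, G.Adj v u ∧ u ∉ A) : s.card ≤ k₂ := by
  have hcard : (s : Set V).encard ≤ k₂ := (Set.encard_le_encard hs).trans (hA.2 v hv)
  rwa [Set.encard_coe_eq_coe_finsetCard, Nat.cast_le] at hcard

theorem IsDefectiveColoring.card_le_mul {A : Set V} (hA : IsDefectiveColoring G k₁ k₂ A)
    {σ ι : Type*} [Fintype σ] [Fintype ι] {x : σ → V} (hx : ∀ s, x s ∉ A) {u : ι → V}
    (hu : Function.Injective u) (huA : ∀ i, u i ∉ A) (hadj : ∀ i, ∃ s, G.Adj (x s) (u i)) :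
    Fintype.card ι ≤ Fintype.card σ * k₂ := by
  classical
  choose s hs using hadj
  by_contra! hlt
  obtain ⟨t, ht⟩ := Fintype.exists_lt_card_fiber_of_mul_lt_card s hlt
  refine ht.not_ge ?_
  rw [← Finset.card_map ⟨u, hu⟩]
  refine hA.card_le (hx t) _ fun v hv => ?_
  simp only [Finset.mem_map, Finset.mem_filter_univ] at hv
  obtain ⟨i, rfl, rfl⟩ := hv
  exact ⟨hs i, huA i⟩

theorem encard_neighborSet_inter_preimage_le (f : G.Copy H) (v : V) (B : Set W) :
    (G.neighborSet v ∩ f ⁻¹' B).encard ≤ (H.neighborSet (f v) ∩ B).encard := by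
  rw [← f.injective.encard_image]
  refine Set.encard_le_encard ?_
  rintro _ ⟨u, ⟨huv, huB⟩, rfl⟩
  exact ⟨f.toHom.map_adj huv, huB⟩

theorem IsDefectiveColoring.comap {A : Set W} (hA : IsDefectiveColoring H k₁ k₂ A)
    (f : G.Copy H) : IsDefectiveColoring G k₁ k₂ (f ⁻¹' A) :=
  ⟨fun v hv => (encard_neighborSet_inter_preimage_le f v A).trans (hA.1 (f v) hv),
    fun v hv => (encard_neighborSet_inter_preimage_le f v Aᶜ).trans (hA.2 (f v) hv)⟩

/-- The forcing property of a gadget `H` with terminals `x s`: in every `(0, k)`-coloring some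
neighbor of some terminal is not colored `0`. -/
def ForcesNonzeroNeighbor {σ : Type*} (H : SimpleGraph W) (k : ℕ) (x : σ → W) : Prop :=
  ∀ A : Set W, IsDefectiveColoring H 0 k A → ∃ s v, H.Adj (x s) v ∧ v ∉ A

theorem not_isDefectiveColorable_of_forcesNonzeroNeighbor {σ ι : Type*} [Fintype σ] [Fintype ι]
    (hcard : Fintype.card σ * k < Fintype.card ι) {x : σ → W} (hH : ForcesNonzeroNeighbor H k x)
    {hub : σ → Bool → V} (hhub : ∀ s, G.Adj (hub s false) (hub s true))
    (f : (σ → Bool) → ι → H.Copy G) (hterminal : ∀ r i s, f r i (x s) = hub s (r s))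
    (hdisj : ∀ r i j s t v w, H.Adj (x s) v → H.Adj (x t) w → f r i v = f r j w → i = j) :
    ¬ IsDefectiveColorable G 0 k := by
  rintro ⟨A, hA⟩
  have hex : ∀ s, ∃ b, hub s b ∉ A := fun s => by
    by_cases hs : hub s false ∈ A
    · exact ⟨true, hA.notMem_of_adj (hhub s) hs⟩
    · exact ⟨false, hs⟩
  choose r hr using hex
  choose s v hadj hv using fun i => hH _ (hA.comap (f r i))
  refine hcard.not_ge (hA.card_le_mul hr (u := fun i => f r i (v i)) ?_ hv fun i => ⟨s i, ?_⟩)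
  · exact fun i j hij => hdisj r i j _ _ _ _ (hadj i) (hadj j) hij
  · rw [← hterminal r i]
    exact (f r i).toHom.map_adj (hadj i)

end DefectiveColoring

/-! ### The gadget -/

/-- The edges of the gadget. -/
inductive GadgetEdge : Type
  | terminalWhite (s : Bool) (i : Fin 4)
  | whiteBig (s : Bool) (i : Fin 4)
  | bigBig (i : Fin 4)
  | bigRed (j : Fin 3) (m : Fin 3) (e : Bool)
  | redRed (j : Fin 3) (m : Fin 3)
  | terminalGreenWhite (s : Bool) (i : Fin 4)
  | greenWhiteNbr (s : Bool) (i : Fin 4)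
  | greenNbrBig (s : Bool) (i : Fin 4)
  deriving DecidableEq, Fintype

namespace GadgetEdge

/-- The two ends of an edge of the gadget. -/
def ends : GadgetEdge → Bool → GadgetVertex
  | terminalWhite s i, b => if b then .inner (.white s i) else .terminal s
  | whiteBig s i, b => if b then .inner (.big s i) else .inner (.white s i)
  | bigBig i, b => .inner (.big b i)
  | bigRed j m e, b =>
      if b then .inner (.red j m e) else .inner (.big (redEnd j m e).1 (redEnd j m e).2)
  | redRed j m, b => .inner (.red j m b)
  | terminalGreenWhite s i, b => if b then .inner (.greenWhite s i) else .terminal s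
  | greenWhiteNbr s i, b => if b then .inner (.greenNbr s i) else .inner (.greenWhite s i)
  | greenNbrBig s i, b => if b then .inner (.big s i) else .inner (.greenNbr s i)

theorem gadgetRel_ends (e : GadgetEdge) : gadgetRel (e.ends false) (e.ends true) ∨
    gadgetRel (e.ends true) (e.ends false) := by
  cases e <;> simp [ends, gadgetRel]

theorem exists_ends_of_gadgetRel {u v : GadgetVertex} (h : gadgetRel u v) :
    ∃ (e : GadgetEdge) (b : Bool), e.ends b = u ∧ e.ends (!b) = v := by
  rcases u with s | ⟨s, i⟩ | ⟨s, i⟩ | ⟨j, m, e⟩ | ⟨s, i⟩ | ⟨s, i⟩ <;>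
  rcases v with t | ⟨t, i'⟩ | ⟨t, i'⟩ | ⟨j', m', e'⟩ | ⟨t, i'⟩ | ⟨t, i'⟩ <;>
  simp only [gadgetRel] at h
  · exact ⟨terminalWhite s i', false, by subst h; exact ⟨rfl, rfl⟩⟩
  · exact ⟨terminalGreenWhite s i', false, by subst h; exact ⟨rfl, rfl⟩⟩
  · obtain ⟨rfl, rfl⟩ := h
    exact ⟨whiteBig s i, false, rfl, rfl⟩
  · obtain ⟨hst, rfl⟩ := h
    exact ⟨bigBig i, s, rfl, by rw [Bool.not_eq.2 hst]; rfl⟩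
  · exact ⟨bigRed j' m' e', false, by simp [ends, ← h], rfl⟩
  · obtain ⟨rfl, rfl, he⟩ := h
    exact ⟨redRed j m, e, rfl, by rw [Bool.not_eq.2 he]; rfl⟩
  · obtain ⟨rfl, rfl⟩ := h
    exact ⟨greenWhiteNbr s i, false, rfl, rfl⟩
  · obtain ⟨rfl, rfl⟩ := h
    exact ⟨greenNbrBig s i, false, rfl, rfl⟩

theorem ends_ne : ∀ (e : GadgetEdge) (b : Bool), e.ends b ≠ e.ends (!b) := by decide

theorem adj (e : GadgetEdge) (b : Bool) : forcingGadget.Adj (e.ends b) (e.ends !b) := by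
  refine (SimpleGraph.fromRel_adj ..).2 ⟨e.ends_ne b, ?_⟩
  cases b
  · exact e.gadgetRel_ends
  · exact e.gadgetRel_ends.symm

end GadgetEdge

theorem forcingGadget_adj_iff {u v : GadgetVertex} :
    forcingGadget.Adj u v ↔ ∃ (e : GadgetEdge) (b : Bool), e.ends b = u ∧ e.ends (!b) = v := by
  constructor
  · intro h
    obtain h | h := ((SimpleGraph.fromRel_adj ..).1 h).2
    · exact GadgetEdge.exists_ends_of_gadgetRel h
    · obtain ⟨e, b, hv, hu⟩ := GadgetEdge.exists_ends_of_gadgetRel h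
      exact ⟨e, !b, hu, by rwa [Bool.not_not]⟩
  · rintro ⟨e, b, rfl, rfl⟩
    exact e.adj b

theorem exists_inner_of_adj_terminal {s : Bool} {v : GadgetVertex}
    (h : forcingGadget.Adj (.terminal s) v) : ∃ u, v = .inner u := by
  have hends : ∀ (e : GadgetEdge) (b s : Bool), e.ends b = .terminal s →
      ∃ u, e.ends (!b) = .inner u := by
    decide
  obtain ⟨e, b, hs, rfl⟩ := forcingGadget_adj_iff.1 h
  exact hends e b s hs

theorem exists_big_three_neighbors_notMem {A : Set GadgetVertex} (hA : forcingGadget.IsIndepSet A)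
    (hwhite : ∀ s i, .inner (.white s i) ∈ A) :
    ∃ s i, .inner (.big s i) ∉ A ∧ ∃ T : Finset GadgetVertex, T.card = 3 ∧
      ∀ v ∈ T, ¬ v.IsGreen ∧ forcingGadget.Adj (.inner (.big s i)) v ∧ v ∉ A := by
  have notMem {u v : GadgetVertex} (huv : forcingGadget.Adj u v) (hu : u ∈ A) : v ∉ A :=
    fun hv => hA hu hv huv.ne huv
  have hbig s i : .inner (.big s i) ∉ A := notMem ((GadgetEdge.whiteBig s i).adj false) (hwhite s i)
  have hred j m : ∃ e, .inner (.red j m e) ∉ A := by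
    by_cases h : .inner (.red j m false) ∈ A
    · exact ⟨true, notMem ((GadgetEdge.redRed j m).adj false) h⟩
    · exact ⟨false, h⟩
  choose e he using hred
  -- nine red pairs, but only eight big vertices
  obtain ⟨⟨j, m⟩, ⟨j', m'⟩, hne, heq⟩ := Fintype.exists_ne_map_eq_of_card_lt
    (fun a : Fin 3 × Fin 3 => redEnd a.1 a.2 (e a.1 a.2)) (by simp)
  rcases hsi : redEnd j m (e j m) with ⟨s, i⟩
  have hadj : ∀ {j m}, redEnd j m (e j m) = (s, i) →
      forcingGadget.Adj (.inner (.big s i)) (.inner (.red j m (e j m))) := fun {j m} h => by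
    simpa [GadgetEdge.ends, h] using (GadgetEdge.bigRed j m (e j m)).adj false
  refine ⟨s, i, hbig s i, {.inner (.big (!s) i), .inner (.red j m (e j m)),
    .inner (.red j' m' (e j' m'))}, Finset.card_eq_three.2 ⟨_, _, _, ?_, ?_, ?_, rfl⟩, ?_⟩
  · simp
  · simp
  · intro h
    injection h with h
    injection h with hj hm
    exact hne (Prod.ext hj hm)
  · simp only [Finset.mem_insert, Finset.mem_singleton, forall_eq_or_imp, forall_eq]
    exact ⟨⟨id, (GadgetEdge.bigBig i).adj s, hbig _ _⟩, ⟨id, hadj hsi, he j m⟩,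
      ⟨id, hadj (heq.symm.trans hsi), he j' m'⟩⟩

theorem forcesNonzeroNeighbor_forcingGadget :
    ForcesNonzeroNeighbor forcingGadget 3 GadgetVertex.terminal := by
  intro A hA
  by_contra! hzero
  have hgreenNbr s i : .inner (.greenNbr s i) ∉ A :=
    hA.notMem_of_adj ((GadgetEdge.greenWhiteNbr s i).adj false)
      (hzero s _ ((GadgetEdge.terminalGreenWhite s i).adj false))
  obtain ⟨s, i, hbig, T, hT, hTA⟩ := exists_big_three_neighbors_notMem hA.isIndepSet fun s i =>
    hzero s _ ((GadgetEdge.terminalWhite s i).adj false)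
  have hcard := hA.card_le hbig (T.cons (.inner (.greenNbr s i)) fun h => (hTA _ h).1 trivial) (by
    simp only [Finset.mem_cons, forall_eq_or_imp]
    exact ⟨⟨(GadgetEdge.greenNbrBig s i).adj true, hgreenNbr s i⟩, fun v hv => (hTA v hv).2⟩)
  rw [Finset.card_cons, hT] at hcard
  omega

theorem forcesNonzeroNeighbor_reducedGadget :
    ForcesNonzeroNeighbor reducedGadget 2 fun s => ⟨.terminal s, id⟩ := by
  classical
  intro A hA
  by_contra! hzero
  have hindep : forcingGadget.IsIndepSet (Subtype.val '' A) := by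
    rintro _ ⟨u, hu, rfl⟩ _ ⟨v, hv, rfl⟩ _ huv
    exact hA.notMem_of_adj (u := u) (v := v) huv hu hv
  obtain ⟨s, i, hbig, T, hT, hTA⟩ := exists_big_three_neighbors_notMem hindep fun s i =>
    ⟨⟨_, id⟩, hzero s _ ((GadgetEdge.terminalWhite s i).adj false), rfl⟩
  have hcard := hA.card_le (v := ⟨.inner (.big s i), id⟩) (fun h => hbig ⟨_, h, rfl⟩)
    (T.subtype (¬ ·.IsGreen)) fun v hv => by
      obtain ⟨-, hadj, hvA⟩ := hTA v (Finset.mem_subtype.1 hv)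
      exact ⟨hadj, fun h => hvA ⟨v, h, rfl⟩⟩
  rw [Finset.card_subtype, Finset.filter_true_of_mem fun v hv => (hTA v hv).1, hT] at hcard
  omega

/-! ### The full construction -/

/-- The edges of the full construction. -/
inductive FullEdge : Type
  | hub (e : Bool)
  | copy (p q : Bool) (c : Fin 7) (e : GadgetEdge)

namespace FullEdge

/-- The two ends of an edge of the full construction. -/
def ends : FullEdge → Bool → FullVertex
  | hub e, b => .hub e b
  | copy p q c e, b => placeCopy p q c (e.ends b)

end FullEdge

theorem placeCopy_injective (p q : Bool) (c : Fin 7) : Function.Injective (placeCopy p q c) := by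
  rintro ((_ | _) | _) ((_ | _) | _) h <;> simp_all [placeCopy]

theorem placeCopy_terminal (p q : Bool) (c : Fin 7) (s : Bool) :
    placeCopy p q c (.terminal s) = .hub s (if s then q else p) := by
  cases s <;> rfl

theorem fullGraph_adj_hub (e : Bool) : fullGraph.Adj (.hub e false) (.hub e true) :=
  (SimpleGraph.fromRel_adj ..).2 ⟨by simp, .inl (.inl ⟨e, rfl, rfl⟩)⟩

theorem fullGraph_adj_placeCopy (p q : Bool) (c : Fin 7) {a b : GadgetVertex}
    (h : forcingGadget.Adj a b) : fullGraph.Adj (placeCopy p q c a) (placeCopy p q c b) :=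
  (SimpleGraph.fromRel_adj ..).2 ⟨(placeCopy_injective p q c).ne h.ne,
    .inl (.inr ⟨p, q, c, a, b, h, rfl, rfl⟩)⟩

theorem fullGraph_adj_iff {u v : FullVertex} :
    fullGraph.Adj u v ↔ ∃ (e : FullEdge) (b : Bool), e.ends b = u ∧ e.ends (!b) = v := by
  constructor
  · intro h
    obtain ⟨-, h⟩ := (SimpleGraph.fromRel_adj ..).1 h
    rcases h with (⟨e, rfl, rfl⟩ | ⟨p, q, c, a, b, hab, rfl, rfl⟩) |
      (⟨e, rfl, rfl⟩ | ⟨p, q, c, a, b, hab, rfl, rfl⟩)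
    · exact ⟨.hub e, false, rfl, rfl⟩
    · obtain ⟨e, b, rfl, rfl⟩ := forcingGadget_adj_iff.1 hab
      exact ⟨.copy p q c e, b, rfl, rfl⟩
    · exact ⟨.hub e, true, rfl, rfl⟩
    · obtain ⟨e, b, rfl, rfl⟩ := forcingGadget_adj_iff.1 hab.symm
      exact ⟨.copy p q c e, b, rfl, rfl⟩
  · rintro ⟨e | ⟨p, q, c, e⟩, b, rfl, rfl⟩
    · cases b
      · exact fullGraph_adj_hub e
      · exact (fullGraph_adj_hub e).symm
    · exact fullGraph_adj_placeCopy p q c (e.adj b)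

theorem exists_placeCopy_of_adj_copy {p q : Bool} {c : Fin 7} {v : GadgetInner} {u : FullVertex}
    (h : fullGraph.Adj (.copy p q c v) u) :
    ∃ a, forcingGadget.Adj (.inner v) a ∧ u = placeCopy p q c a := by
  obtain ⟨e | ⟨p', q', c', e⟩, b, hv, rfl⟩ := fullGraph_adj_iff.1 h
  · cases hv
  · rcases hb : e.ends b with (_ | _) | w <;> simp only [FullEdge.ends, hb, placeCopy] at hv <;>
      cases hv
    exact ⟨e.ends !b, hb ▸ e.adj b, rfl⟩

/-- A function on the vertices of the gadget that changes by at most `1` along every edge and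
shows that the distance of the terminals is at least `5`. -/
def gadgetLevel : GadgetVertex → ℕ
  | .terminal s => if s then 5 else 0
  | .inner (.white s _) => if s then 4 else 1
  | .inner (.big s _) => if s then 3 else 2
  | .inner (.red j m e) => if (redEnd j m e).1 then 3 else 2
  | .inner (.greenWhite s _) => if s then 4 else 1
  | .inner (.greenNbr s _) => if s then 3 else 2

/-- The function `gadgetLevel` on all copies of the gadget. -/
def fullLevel : FullVertex → ℕ
  | .hub e _ => gadgetLevel (.terminal e)
  | .copy _ _ _ v => gadgetLevel (.inner v)

theorem gadgetLevel_ends_not_le : ∀ (e : GadgetEdge) (b : Bool),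
    gadgetLevel (e.ends !b) ≤ gadgetLevel (e.ends b) + 1 := by
  decide

theorem fullLevel_placeCopy (p q : Bool) (c : Fin 7) (a : GadgetVertex) :
    fullLevel (placeCopy p q c a) = gadgetLevel a := by
  rcases a with (_ | _) | _ <;> rfl

theorem fullLevel_le_of_adj {u v : FullVertex} (h : fullGraph.Adj u v) :
    fullLevel v ≤ fullLevel u + 1 := by
  obtain ⟨e | ⟨p, q, c, e⟩, b, rfl, rfl⟩ := fullGraph_adj_iff.1 h
  · simp [FullEdge.ends, fullLevel]
  · simpa [FullEdge.ends, fullLevel_placeCopy] using gadgetLevel_ends_not_le e b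

theorem fullGraph_adj_placeCopy_iff (p q : Bool) (c : Fin 7) {a b : GadgetVertex} :
    fullGraph.Adj (placeCopy p q c a) (placeCopy p q c b) ↔ forcingGadget.Adj a b := by
  refine ⟨fun h => ?_, fullGraph_adj_placeCopy p q c⟩
  rcases a with s | a
  · rcases b with t | b
    · have hts := fullLevel_le_of_adj h
      have hst := fullLevel_le_of_adj h.symm
      rw [fullLevel_placeCopy, fullLevel_placeCopy] at hts hst
      cases s <;> cases t <;> simp [gadgetLevel] at h hts hst
    · obtain ⟨x, hx, hbx⟩ := exists_placeCopy_of_adj_copy h.symm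
      exact (placeCopy_injective p q c hbx ▸ hx).symm
  · obtain ⟨x, hx, hbx⟩ := exists_placeCopy_of_adj_copy h
    exact placeCopy_injective p q c hbx ▸ hx

/-- A copy of the gadget as an induced subgraph of the full construction. -/
def placeCopyEmbedding (p q : Bool) (c : Fin 7) : forcingGadget ↪g fullGraph where
  toFun := placeCopy p q c
  inj' := placeCopy_injective p q c
  map_rel_iff' := fullGraph_adj_placeCopy_iff p q c

theorem not_isGreen_placeCopy (p q : Bool) {c : Fin 7} (hc : ¬ 5 ≤ c) {a : GadgetVertex}
    (ha : ¬ a.IsGreen) : ¬ (placeCopy p q c a).IsGreen := by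
  rcases a with (_ | _) | v
  · exact id
  · exact id
  · exact not_or.2 ⟨hc, ha⟩

/-- A copy of the reduced gadget in the reduced construction. -/
def reducedPlaceCopy (p q : Bool) {c : Fin 7} (hc : ¬ 5 ≤ c) :
    reducedGadget.Copy reducedGraph where
  toHom := ⟨fun a => ⟨placeCopy p q c a.1, not_isGreen_placeCopy p q hc a.2⟩,
    fullGraph_adj_placeCopy p q c⟩
  injective' _ _ hab := Subtype.ext (placeCopy_injective p q c (congrArg Subtype.val hab))

theorem eq_of_placeCopy_eq_of_adj_terminal {p q s t : Bool} {c d : Fin 7} {v w : GadgetVertex}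
    (hv : forcingGadget.Adj (.terminal s) v) (hw : forcingGadget.Adj (.terminal t) w)
    (h : placeCopy p q c v = placeCopy p q d w) : c = d := by
  obtain ⟨v, rfl⟩ := exists_inner_of_adj_terminal hv
  obtain ⟨w, rfl⟩ := exists_inner_of_adj_terminal hw
  exact (FullVertex.copy.inj h).2.2.1

theorem not_isDefectiveColorable_fullGraph : ¬ IsDefectiveColorable fullGraph 0 3 := by
  refine not_isDefectiveColorable_of_forcesNonzeroNeighbor (ι := Fin 7) (by decide)
    forcesNonzeroNeighbor_forcingGadget (hub := FullVertex.hub) fullGraph_adj_hub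
    (fun r c => (placeCopyEmbedding (r false) (r true) c).toCopy) ?_ ?_
  · rintro r c (_ | _) <;> rfl
  · exact fun r c d s t v w => eq_of_placeCopy_eq_of_adj_terminal

theorem not_isDefectiveColorable_reducedGraph : ¬ IsDefectiveColorable reducedGraph 0 2 := by
  refine not_isDefectiveColorable_of_forcesNonzeroNeighbor (ι := {c : Fin 7 // ¬ 5 ≤ c})
    (by decide) forcesNonzeroNeighbor_reducedGadget (hub := fun e p => ⟨.hub e p, id⟩)
    fullGraph_adj_hub (fun r c => reducedPlaceCopy (r false) (r true) c.2) ?_ ?_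
  · rintro r c (_ | _) <;> rfl
  · exact fun r c d s t v w hv hw h =>
      Subtype.ext (eq_of_placeCopy_eq_of_adj_terminal hv hw (congrArg Subtype.val h))

instance : DecidablePred GadgetVertex.IsGreen
  | .inner (.greenWhite _ _) | .inner (.greenNbr _ _) => isTrue trivial
  | .terminal _ | .inner (.white _ _) | .inner (.big _ _) | .inner (.red _ _ _) => isFalse id

instance : DecidablePred FullVertex.IsGreen
  | .hub _ _ => isFalse id
  | .copy _ _ c v => inferInstanceAs (Decidable (5 ≤ c ∨ (GadgetVertex.inner v).IsGreen))

theorem card_reducedGraph : Nat.card {v : FullVertex // ¬ v.IsGreen} = 684 := by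
  rw [Nat.card_eq_fintype_card]
  -- four hubs, and `34` inner vertices that are not green in each of `4 * 5` copies
  decide +kernel

/-! ### Short cycles -/

section Walks

variable {V W : Type*} {G : SimpleGraph V} {H : SimpleGraph W}

/-- The vertex lists of the paths of length `n` to `v` in the graph with neighbor lists `nbrs`. -/
def pathsTo [DecidableEq V] (nbrs : V → List V) (v : V) : ℕ → List (List V)
  | 0 => [[v]]
  | n + 1 => (pathsTo nbrs v n).flatMap fun l =>
      ((nbrs (l.headD v)).filter (· ∉ l)).map (· :: l)

theorem support_mem_pathsTo [DecidableEq V] {nbrs : V → List V}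
    (hnbrs : ∀ u v, G.Adj u v → v ∈ nbrs u) {u v : V} {w : G.Walk u v} (hw : w.IsPath) :
    w.support ∈ pathsTo nbrs v w.length := by
  induction w with
  | nil => simp [pathsTo]
  | cons huv w ih =>
    rw [SimpleGraph.Walk.cons_isPath_iff] at hw
    refine List.mem_flatMap.2 ⟨_, ih hw.1, List.mem_map_of_mem (List.mem_filter.2 ⟨?_, ?_⟩)⟩
    · rw [← w.cons_tail_support]
      exact hnbrs _ _ huv.symm
    · simpa using hw.2

theorem le_add_length_of_forall_adj_le {f : V → ℕ} (hf : ∀ {u v}, G.Adj u v → f v ≤ f u + 1)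
    {u v : V} (w : G.Walk u v) : f v ≤ f u + w.length := by
  induction w with
  | nil => simp
  | cons huv w ih =>
    have := hf huv
    rw [SimpleGraph.Walk.length_cons]
    omega

theorem two_mul_le_add_length_of_mem_support {f : V → ℕ}
    (hf : ∀ {u v}, G.Adj u v → f v ≤ f u + 1) {a u v : V} (w : G.Walk a a)
    (hu : u ∈ w.support) (hv : v ∈ w.support) : 2 * f v ≤ 2 * f u + w.length := by
  classical
  have hv' := (SimpleGraph.Walk.mem_support_rotate_iff w _ hu).2 hv
  have hto := le_add_length_of_forall_adj_le hf ((w.rotate _ hu).takeUntil _ hv')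
  have hfrom := le_add_length_of_forall_adj_le hf ((w.rotate _ hu).dropUntil _ hv').reverse
  have hlen := congrArg SimpleGraph.Walk.length ((w.rotate _ hu).take_spec hv')
  rw [SimpleGraph.Walk.length_append, SimpleGraph.Walk.length_rotate] at hlen
  rw [SimpleGraph.Walk.length_reverse] at hfrom
  omega

theorem mem_support_of_leaves {S : Set V} {h u v : V} (w : G.Walk u v)
    (hS : ∀ x ∈ S, ∀ y ∈ w.support, G.Adj x y → y ∈ S ∨ y = h) (hu : u ∈ S) (hv : v ∉ S) :
    h ∈ w.support := by
  obtain ⟨d, hd, hfst, hsnd⟩ := w.exists_boundary_dart S hu hv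
  have hmem := w.dart_snd_mem_support_of_mem_darts hd
  exact (hS _ hfst _ hmem d.adj).resolve_left hsnd ▸ hmem

theorem mem_or_eq_of_isCycle {S : Set V} {u h v : V} {w : G.Walk u u} (hw : w.IsCycle)
    (hS : ∀ x ∈ S, ∀ y ∈ w.support, G.Adj x y → y ∈ S ∨ y = h) (hu : u ∈ S) (hh : h ∉ S)
    (hv : v ∈ w.support) : v ∈ S ∨ v = h := by
  classical
  by_contra! hcon
  obtain ⟨hvS, hvh⟩ := hcon
  have hto : h ∈ (w.takeUntil v hv).support := mem_support_of_leaves _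
    (fun x hx y hy => hS x hx y (w.support_takeUntil_subset_support hv hy)) hu hvS
  have hfrom : h ∈ (w.dropUntil v hv).reverse.support := mem_support_of_leaves _
    (fun x hx y hy => hS x hx y (w.support_dropUntil_subset_support hv (by simpa using hy))) hu hvS
  rw [SimpleGraph.Walk.support_reverse, List.mem_reverse] at hfrom
  have hnodup := hw.support_nodup
  rw [← w.take_spec hv, SimpleGraph.Walk.tail_support_append, List.nodup_append'] at hnodup
  exact List.disjoint_left.1 hnodup.2.2
    (((w.takeUntil v hv).mem_support_iff.1 hto).resolve_left fun hhu => hh (hhu ▸ hu))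
    (((w.dropUntil v hv).mem_support_iff.1 hfrom).resolve_left hvh.symm)

theorem exists_map_copy_eq (f : G ↪g H) {u v : W} (w : H.Walk u v)
    (hw : ∀ x ∈ w.support, x ∈ Set.range f) {a b : V} (ha : f a = u) (hb : f b = v) :
    ∃ w' : G.Walk a b, (w'.map f.toHom).copy ha hb = w := by
  induction w generalizing a with
  | nil =>
    subst ha
    obtain rfl := f.injective hb
    exact ⟨.nil, rfl⟩
  | cons h w ih =>
    obtain ⟨y, rfl⟩ := hw _ (List.mem_cons_of_mem _ w.start_mem_support)
    obtain ⟨w', rfl⟩ := ih (fun z hz => hw z (List.mem_cons_of_mem _ hz)) rfl hb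
    subst ha hb
    exact ⟨.cons (f.map_rel_iff.1 h) w', rfl⟩

theorem exists_isCycle_of_support_subset_range (f : G ↪g H) {u : W} {w : H.Walk u u}
    (hw : w.IsCycle) (hrange : ∀ x ∈ w.support, x ∈ Set.range f) :
    ∃ (a : V) (w' : G.Walk a a), w'.IsCycle ∧ w'.length = w.length ∧
      w'.support.map f = w.support := by
  obtain ⟨a, rfl⟩ := hrange u w.start_mem_support
  obtain ⟨w', rfl⟩ := exists_map_copy_eq f w hrange rfl rfl
  exact ⟨a, w', SimpleGraph.Walk.IsCycle.of_map (f := f.toHom) hw,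
    (w'.length_map f.toHom).symm, (w'.support_map f.toHom).symm⟩

end Walks

/-- The list of the neighbors of a vertex of the gadget. -/
def gadgetNbrs : GadgetVertex → List GadgetVertex
  | .terminal s => (List.finRange 4).flatMap fun i =>
      [.inner (.white s i), .inner (.greenWhite s i)]
  | .inner (.white s i) => [.terminal s, .inner (.big s i)]
  | .inner (.big s i) => [.inner (.white s i), .inner (.greenNbr s i), .inner (.big (!s) i)] ++
      ((List.finRange 3).flatMap fun j => (List.finRange 3).flatMap fun m =>
        [false, true].flatMap fun e => if (s, i) = redEnd j m e then [.inner (.red j m e)] else [])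
  | .inner (.red j m e) => [.inner (.red j m !e), .inner (.big (redEnd j m e).1 (redEnd j m e).2)]
  | .inner (.greenWhite s i) => [.terminal s, .inner (.greenNbr s i)]
  | .inner (.greenNbr s i) => [.inner (.greenWhite s i), .inner (.big s i)]

theorem mem_gadgetNbrs_of_adj (u v : GadgetVertex) (h : forcingGadget.Adj u v) :
    v ∈ gadgetNbrs u := by
  have hends : ∀ (e : GadgetEdge) (b : Bool), e.ends (!b) ∈ gadgetNbrs (e.ends b) := by
    decide +kernel
  obtain ⟨e, b, rfl, rfl⟩ := forcingGadget_adj_iff.1 h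
  exact hends e b

theorem eq_four_and_exists_isGreen_of_mem_pathsTo : ∀ a, ∀ n ∈ Finset.Icc 2 5,
    ∀ l ∈ pathsTo gadgetNbrs a n, l.headD a ∈ gadgetNbrs a → n = 4 ∧ ∃ v ∈ l, v.IsGreen := by
  decide +kernel

theorem forcingGadget_length_eq_five_of_isCycle {a : GadgetVertex} {w : forcingGadget.Walk a a}
    (hw : w.IsCycle) (hlen : w.length ≤ 6) : w.length = 5 ∧ ∃ v ∈ w.support, v.IsGreen := by
  have hthree := hw.three_le_length
  cases w with
  | nil => simp at hthree
  | cons hav w =>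
    rw [SimpleGraph.Walk.cons_isCycle_iff] at hw
    rw [SimpleGraph.Walk.length_cons] at hthree hlen
    obtain ⟨hfour, v, hv, hgreen⟩ := eq_four_and_exists_isGreen_of_mem_pathsTo a w.length
      (Finset.mem_Icc.2 ⟨by omega, by omega⟩) w.support
      (support_mem_pathsTo mem_gadgetNbrs_of_adj hw.1)
      (w.cons_tail_support ▸ mem_gadgetNbrs_of_adj a _ hav)
    exact ⟨by rw [SimpleGraph.Walk.length_cons, hfour], v, List.mem_cons_of_mem _ hv, hgreen⟩

theorem eq_and_eq_not_of_adj_hub {e e' p p' : Bool} (h : fullGraph.Adj (.hub e p) (.hub e' p')) :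
    e' = e ∧ p' = !p := by
  have hle := fullLevel_le_of_adj h
  have hge := fullLevel_le_of_adj h.symm
  cases e <;> cases e' <;> cases p <;> cases p' <;> simp [fullLevel, gadgetLevel] at h hle hge ⊢

theorem exists_copy_mem_of_isCycle {a : FullVertex} {w : fullGraph.Walk a a} (hw : w.IsCycle) :
    ∃ p q c v, .copy p q c v ∈ w.support := by
  by_contra! hcon
  have hub : ∀ u ∈ w.support, ∃ e p, u = .hub e p
    | .hub e p, _ => ⟨e, p, rfl⟩
    | .copy p q c v, hu => (hcon p q c v hu).elim
  obtain ⟨e, p, rfl⟩ := hub a w.start_mem_support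
  have eq_of_adj : ∀ u ∈ w.support, fullGraph.Adj (.hub e p) u → u = .hub e !p := fun u hu h => by
    obtain ⟨e', p', rfl⟩ := hub u hu
    obtain ⟨rfl, rfl⟩ := eq_and_eq_not_of_adj_hub h
    rfl
  apply hw.snd_ne_penultimate
  rw [eq_of_adj w.snd (w.getVert_mem_support _) (w.adj_snd hw.not_nil),
    eq_of_adj w.penultimate (w.getVert_mem_support _) (w.adj_penultimate hw.not_nil).symm]

theorem exists_terminal_notMem_support {a : FullVertex} (w : fullGraph.Walk a a)
    (hlen : w.length < 10) (p q : Bool) (c : Fin 7) :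
    ∃ s, placeCopy p q c (.terminal s) ∉ w.support := by
  by_contra! hcon
  have := two_mul_le_add_length_of_mem_support fullLevel_le_of_adj w (hcon false) (hcon true)
  simp only [fullLevel_placeCopy, gadgetLevel, Bool.false_eq_true, if_false, if_true] at this
  omega

theorem exists_support_subset_range_placeCopy {a : FullVertex} {w : fullGraph.Walk a a}
    (hw : w.IsCycle) (hlen : w.length < 10) :
    ∃ p q c, ∀ u ∈ w.support, u ∈ Set.range (placeCopy p q c) := by
  obtain ⟨p, q, c, v, hv⟩ := exists_copy_mem_of_isCycle hw
  obtain ⟨s, hs⟩ := exists_terminal_notMem_support w hlen p q c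
  have mem_rotate {u : FullVertex} : u ∈ (w.rotate _ hv).support ↔ u ∈ w.support :=
    SimpleGraph.Walk.mem_support_rotate_iff w _ hv
  have hnbr : ∀ x ∈ Set.range (FullVertex.copy p q c), ∀ y ∈ (w.rotate _ hv).support,
      fullGraph.Adj x y →
        y ∈ Set.range (FullVertex.copy p q c) ∨ y = placeCopy p q c (.terminal !s) := by
    rintro _ ⟨u, rfl⟩ y hy huy
    obtain ⟨t | b, -, rfl⟩ := exists_placeCopy_of_adj_copy huy
    · have hts : t ≠ s := fun hts => hs (hts ▸ mem_rotate.1 hy)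
      exact .inr (by rw [Bool.eq_not.2 hts])
    · exact .inl ⟨b, rfl⟩
  refine ⟨p, q, c, fun u hu => ?_⟩
  obtain ⟨b, rfl⟩ | rfl := mem_or_eq_of_isCycle (hw.rotate hv) hnbr ⟨v, rfl⟩
    (by rw [placeCopy_terminal]; simp) (mem_rotate.2 hu)
  · exact ⟨.inner b, rfl⟩
  · exact ⟨_, rfl⟩

theorem fullGraph_length_eq_five_of_isCycle {a : FullVertex} {w : fullGraph.Walk a a}
    (hw : w.IsCycle) (hlen : w.length ≤ 6) : w.length = 5 ∧ ∃ v ∈ w.support, v.IsGreen := by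
  obtain ⟨p, q, c, hrange⟩ := exists_support_subset_range_placeCopy hw (by omega)
  obtain ⟨_, w', hw', hlength, hsupport⟩ :=
    exists_isCycle_of_support_subset_range (placeCopyEmbedding p q c) hw hrange
  obtain ⟨hfive, v, hv, hgreen⟩ := forcingGadget_length_eq_five_of_isCycle hw' (by omega)
  refine ⟨by omega, placeCopy p q c v, hsupport ▸ List.mem_map_of_mem hv, ?_⟩
  rcases v with _ | v
  · exact hgreen.elim
  · exact .inr hgreen

theorem cycleGraph_free_fullGraph {n : ℕ} (hthree : 3 ≤ n) (hsix : n ≤ 6) (hfive : n ≠ 5) :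
    (SimpleGraph.cycleGraph n).Free fullGraph := by
  intro h
  obtain ⟨v, w, hw, rfl⟩ := (SimpleGraph.cycleGraph_isContained_iff hthree).1 h
  exact hfive (fullGraph_length_eq_five_of_isCycle hw hsix).1

theorem seven_le_egirth_reducedGraph : 7 ≤ reducedGraph.egirth := by
  rw [SimpleGraph.le_egirth]
  intro a w hw
  by_contra! hlt
  have hlt : w.length < 7 := by exact_mod_cast hlt
  let f : reducedGraph ↪g fullGraph := SimpleGraph.Embedding.induce _
  obtain ⟨-, v, hv, hgreen⟩ := fullGraph_length_eq_five_of_isCycle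
    (hw.map (f := f.toHom) f.injective) (by rw [SimpleGraph.Walk.length_map]; omega)
  rw [SimpleGraph.Walk.support_map, List.mem_map] at hv
  obtain ⟨u, -, rfl⟩ := hv
  exact u.2 hgreen

/-- The vertices of a `7`-cycle of the reduced gadget: a terminal, two big vertices attached to it,
and a red pair between these. -/
def gadgetCycle : Fin 7 → GadgetVertex := ![.terminal false, .inner (.white false 0),
  .inner (.big false 0), .inner (.red 0 0 false), .inner (.red 0 0 true), .inner (.big false 1),
  .inner (.white false 1)]

theorem gadgetCycle_injective : Function.Injective gadgetCycle := by decide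

theorem not_isGreen_gadgetCycle : ∀ i, ¬ (gadgetCycle i).IsGreen := by decide

theorem gadgetCycle_adj (i : Fin 7) : forcingGadget.Adj (gadgetCycle i) (gadgetCycle (i + 1)) := by
  rw [forcingGadget_adj_iff]
  revert i
  decide

/-- The copy of the `7`-cycle in the reduced gadget given by `gadgetCycle`. -/
def gadgetCycleCopy : (SimpleGraph.cycleGraph 7).Copy reducedGadget where
  toHom := ⟨fun i => ⟨gadgetCycle i, not_isGreen_gadgetCycle i⟩, fun {i j} hij => by
    obtain hij | hij := SimpleGraph.cycleGraph_adj.1 hij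
    · exact (sub_eq_iff_eq_add'.1 hij ▸ gadgetCycle_adj j).symm
    · exact sub_eq_iff_eq_add'.1 hij ▸ gadgetCycle_adj i⟩
  injective' _ _ hij := gadgetCycle_injective (congrArg Subtype.val hij)

theorem egirth_reducedGraph : reducedGraph.egirth = 7 := by
  have hcontained : (SimpleGraph.cycleGraph 7).IsContained reducedGraph :=
    ⟨(reducedPlaceCopy false false (c := 0) (by decide)).comp gadgetCycleCopy⟩
  obtain ⟨v, w, hw, hseven⟩ :=
    (SimpleGraph.cycleGraph_isContained_iff (by norm_num)).1 hcontained
  refine le_antisymm ?_ seven_le_egirth_reducedGraph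
  simpa [hseven] using SimpleGraph.egirth_le_length hw

/-! ### Plane drawings -/

theorem IsPlanarGraph.comap {V W : Type*} {G : SimpleGraph V} {H : SimpleGraph W}
    (hH : IsPlanarGraph H) (f : G.Copy H) : IsPlanarGraph G := by
  obtain ⟨pos, arc, hpos, harc, hvert, hdisj⟩ := hH
  have hedge : ∀ e ∈ G.edgeSet, e.map f ∈ H.edgeSet := fun e he => f.toHom.map_mem_edgeSet he
  refine ⟨pos ∘ f, arc ∘ Sym2.map f, hpos.comp f.injective,
    fun u v h => harc _ _ (f.toHom.map_adj h), ?_, ?_⟩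
  · intro e he w hw
    obtain ⟨a, ha, haw⟩ := Sym2.mem_map.1 (hvert _ (hedge e he) _ hw)
    exact f.injective haw ▸ ha
  · intro e he e' he' hne z hz
    obtain ⟨w, ⟨hw, hw'⟩, rfl⟩ := hdisj _ (hedge e he) _ (hedge e' he')
      ((Sym2.map.injective f.injective).ne hne) hz
    obtain ⟨a, ha, rfl⟩ := Sym2.mem_map.1 hw
    obtain ⟨b, hb, hba⟩ := Sym2.mem_map.1 hw'
    exact ⟨a, ⟨ha, f.injective hba ▸ hb⟩, rfl⟩

theorem IsPlaneArc.symm {A : Set (ℝ × ℝ)} {p q : ℝ × ℝ} (h : IsPlaneArc A p q) :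
    IsPlaneArc A q p := by
  obtain ⟨γ, hcont, hinj, hzero, hone, hrange⟩ := h
  refine ⟨γ ∘ unitInterval.symm, hcont.comp unitInterval.continuous_symm,
    hinj.comp unitInterval.symm_bijective.injective, ?_, ?_, ?_⟩
  · rw [Function.comp_apply, unitInterval.symm_zero, hone]
  · rw [Function.comp_apply, unitInterval.symm_one, hzero]
  · rw [unitInterval.symm_bijective.surjective.range_comp, hrange]

theorem isPlanarGraph_of_curves {V E : Type*} {G : SimpleGraph V} {pos : V → ℝ × ℝ}
    {ends : E → Bool → V} {γ : E → unitInterval → ℝ × ℝ}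
    (hpos : Function.Injective pos)
    (hends : ∀ {u v}, G.Adj u v → ∃ e b, ends e b = u ∧ ends e (!b) = v)
    (hcont : ∀ e, Continuous (γ e)) (hinj : ∀ e, Function.Injective (γ e))
    (hzero : ∀ e, γ e 0 = pos (ends e false)) (hone : ∀ e, γ e 1 = pos (ends e true))
    (hvert : ∀ e v, pos v ∈ Set.range (γ e) → v ∈ Set.range (ends e))
    (hmeet : ∀ e f, e ≠ f → Set.range (γ e) ∩ Set.range (γ f) ⊆ pos '' Set.range (ends e)) :
    IsPlanarGraph G := by
  have hrep : ∀ z ∈ G.edgeSet, ∃ e, z = s(ends e false, ends e true) := by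
    rintro ⟨u, v⟩ huv
    obtain ⟨e, _ | _, rfl, rfl⟩ := hends huv
    · exact ⟨e, rfl⟩
    · exact ⟨e, Sym2.eq_swap⟩
  choose r hr using hrep
  have mem_of_mem_range {z e v} (hz : z = s(ends e false, ends e true))
      (hv : v ∈ Set.range (ends e)) : v ∈ z := by
    obtain ⟨_ | _, rfl⟩ := hv
    · exact hz ▸ Sym2.mem_mk_left _ _
    · exact hz ▸ Sym2.mem_mk_right _ _
  have harc : ∀ e, IsPlaneArc (Set.range (γ e)) (pos (ends e false)) (pos (ends e true)) :=
    fun e => ⟨γ e, hcont e, hinj e, hzero e, hone e, rfl⟩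
  refine ⟨pos, fun z => ⋃ hz : z ∈ G.edgeSet, Set.range (γ (r z hz)), hpos, ?_, ?_, ?_⟩
  · intro u v huv
    have huv : s(u, v) ∈ G.edgeSet := huv
    simp only [huv, Set.iUnion_true]
    have harc := harc (r _ huv)
    obtain ⟨hu, hv⟩ | ⟨hu, hv⟩ := Sym2.eq_iff.1 (hr _ huv)
    · rwa [← hu, ← hv] at harc
    · rw [← hu, ← hv] at harc
      exact harc.symm
  · intro z _ v hv
    obtain ⟨hz, hv⟩ := Set.mem_iUnion.1 hv
    exact mem_of_mem_range (hr z hz) (hvert _ v hv)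
  · rintro y - z - hyz x ⟨hxy, hxz⟩
    obtain ⟨hy, hxy⟩ := Set.mem_iUnion.1 hxy
    obtain ⟨hz, hxz⟩ := Set.mem_iUnion.1 hxz
    have hne : r y hy ≠ r z hz := fun h => hyz (by rw [hr y hy, hr z hz, h])
    obtain ⟨v, hv, rfl⟩ := hmeet _ _ hne ⟨hxy, hxz⟩
    exact ⟨v, ⟨mem_of_mem_range (hr y hy) hv, mem_of_mem_range (hr z hz) (hvert _ v hxz)⟩, rfl⟩

/-! ### Segments -/

/-- The segment from `P false` to `P true`, as a parametrized curve. -/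
def segmentCurve (P : Bool → ℝ × ℝ) (t : unitInterval) : ℝ × ℝ :=
  AffineMap.lineMap (P false) (P true) (t : ℝ)

theorem continuous_segmentCurve (P : Bool → ℝ × ℝ) : Continuous (segmentCurve P) :=
  AffineMap.lineMap_continuous.comp continuous_subtype_val

theorem segmentCurve_injective {P : Bool → ℝ × ℝ} (hP : P false ≠ P true) :
    Function.Injective (segmentCurve P) :=
  (AffineMap.lineMap_injective ℝ hP).comp Subtype.val_injective

theorem segmentCurve_zero (P : Bool → ℝ × ℝ) : segmentCurve P 0 = P false :=
  AffineMap.lineMap_apply_zero _ _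

theorem segmentCurve_one (P : Bool → ℝ × ℝ) : segmentCurve P 1 = P true :=
  AffineMap.lineMap_apply_one _ _

theorem segmentCurve_mem {S : Set (ℝ × ℝ)} (hS : Convex ℝ S) {P : Bool → ℝ × ℝ}
    (hP : ∀ b, P b ∈ S) (t : unitInterval) : segmentCurve P t ∈ S :=
  hS.lineMap_mem (hP false) (hP true) t.2

section Orientation

variable {R : Type*} [CommRing R]

/-- Twice the signed area of the triangle `PQT`. -/
def orient (P Q T : R × R) : R :=
  (Q.1 - P.1) * (T.2 - P.2) - (Q.2 - P.2) * (T.1 - P.1)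

theorem orient_lineMap (P Q S T : R × R) (t : R) :
    orient P Q (AffineMap.lineMap S T t) = AffineMap.lineMap (orient P Q S) (orient P Q T) t := by
  simp only [orient, AffineMap.lineMap_apply_module', Prod.fst_add, Prod.snd_add, Prod.smul_fst,
    Prod.smul_snd, Prod.fst_sub, Prod.snd_sub, smul_eq_mul]
  ring

theorem orient_left (P Q : R × R) : orient P Q P = 0 := by
  rw [orient]
  ring

theorem orient_right (P Q : R × R) : orient P Q Q = 0 := by
  rw [orient]
  ring

/-- The segment with ends `Q` lies strictly on one side of the line through the points `P`, or it
has exactly one end on that line, and this end is one of the points `P`. Two segments in such a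
position meet at most in a common end. -/
def LiesBeside [LinearOrder R] (P Q : Bool → R × R) : Prop :=
  0 < orient (P false) (P true) (Q false) * orient (P false) (P true) (Q true) ∨
    ∃ b c, Q b = P c ∧ orient (P false) (P true) (Q !b) ≠ 0

instance [LinearOrder R] (P Q : Bool → R × R) : Decidable (LiesBeside P Q) :=
  inferInstanceAs (Decidable (_ ∨ _))

end Orientation

theorem LiesBeside.range_inter_subset {P Q : Bool → ℝ × ℝ} (h : LiesBeside P Q) :
    Set.range (segmentCurve P) ∩ Set.range (segmentCurve Q) ⊆ Set.range P ∩ Set.range Q := by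
  rintro _ ⟨⟨s, rfl⟩, ⟨t, hst⟩⟩
  have hzero : AffineMap.lineMap (orient (P false) (P true) (Q false))
      (orient (P false) (P true) (Q true)) (t : ℝ) = 0 := by
    rw [← orient_lineMap, ← segmentCurve, hst, segmentCurve, orient_lineMap, orient_left,
      orient_right, AffineMap.lineMap_same_apply]
  rw [← hst]
  obtain hpos | ⟨b, c, hbc, hne⟩ := h
  · exfalso
    obtain ⟨hfalse, htrue⟩ | ⟨hfalse, htrue⟩ := mul_pos_iff.1 hpos
    · exact ((convex_Ioi (0 : ℝ)).lineMap_mem hfalse htrue t.2).ne' hzero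
    · exact ((convex_Iio (0 : ℝ)).lineMap_mem hfalse htrue t.2).ne hzero
  · have hb : orient (P false) (P true) (Q b) = 0 := by
      rw [hbc]
      cases c
      · exact orient_left _ _
      · exact orient_right _ _
    suffices segmentCurve Q t = Q b by rw [this]; exact ⟨⟨c, hbc.symm⟩, ⟨b, rfl⟩⟩
    rw [← hb] at hzero
    cases b
    · rw [AffineMap.lineMap_eq_left_iff, hb] at hzero
      rw [segmentCurve, hzero.resolve_left hne.symm, AffineMap.lineMap_apply_zero]
    · rw [AffineMap.lineMap_eq_right_iff, hb] at hzero
      rw [segmentCurve, hzero.resolve_left hne, AffineMap.lineMap_apply_one]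

/-- The point of the plane with the given integral coordinates. -/
def latticePoint (z : ℤ × ℤ) : ℝ × ℝ := (z.1, z.2)

theorem latticePoint_injective : Function.Injective latticePoint := fun y z h => by
  simpa [latticePoint, Prod.ext_iff] using h

theorem orient_latticePoint (P Q T : ℤ × ℤ) :
    orient (latticePoint P) (latticePoint Q) (latticePoint T) = orient P Q T := by
  simp [orient, latticePoint]

theorem LiesBeside.latticePoint {P Q : Bool → ℤ × ℤ} (h : LiesBeside P Q) :
    LiesBeside (latticePoint ∘ P) (latticePoint ∘ Q) := by
  simp only [LiesBeside, Function.comp_apply, orient_latticePoint, latticePoint_injective.eq_iff]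
  exact_mod_cast h

/-! ### The drawing of the gadget -/

/-- The rectangle in which the gadget is drawn, with its vertical sides; all points of one of these
sides stand for the same terminal. -/
def strip : Set (ℝ × ℝ) := Set.Icc 0 40 ×ˢ Set.Ioo 0 42

/-- The first coordinate of the points on the side of the strip that stands for a terminal. -/
def stripSide (s : Bool) : ℤ := if s then 40 else 0

/-- The positions of the vertices of the gadget in the strip; the height of a terminal on its side
is arbitrary. -/
def gadgetPos : GadgetVertex → ℤ × ℤ
  | .terminal s => (stripSide s, 1)
  | .inner (.white s i) => (if s then 35 else 5, 10 * (i : ℕ) + if s then 7 else 6)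
  | .inner (.big s i) => (if s then 30 else 10, 10 * (i : ℕ) + 5)
  | .inner (.red j m e) =>
      (if m = 0 then (if e then 12 else 11) else if m = 1 then (if e then 28 else 29)
        else (if e then 23 else 17),
       10 * (j : ℕ) + if e then 11 else if m = 2 then 8 else 9)
  | .inner (.greenWhite s i) => (if s then 37 else 3, 10 * (i : ℕ) + if s then 4 else 3)
  | .inner (.greenNbr s i) => (if s then 34 else 6, 10 * (i : ℕ) + 2)

theorem gadgetPos_injective : Function.Injective gadgetPos := by
  have : ∀ a b, gadgetPos a = gadgetPos b → a = b := by decide +kernel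
  exact fun a b => this a b

theorem eq_terminal_of_gadgetPos_fst : ∀ (a : GadgetVertex) (s : Bool),
    (gadgetPos a).1 = stripSide s → a = .terminal s := by
  decide +kernel

theorem gadgetPos_fst_mem : ∀ a, (gadgetPos a).1 ∈ Finset.Icc 0 40 := by
  decide +kernel

theorem gadgetPos_snd_mem : ∀ a, (gadgetPos a).2 ∈ Finset.Ioo 0 42 := by
  decide +kernel

theorem latticePoint_mem_strip {x y : ℤ} (hx : x ∈ Finset.Icc 0 40) (hy : y ∈ Finset.Ioo 0 42) :
    latticePoint (x, y) ∈ strip := by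
  rw [Finset.mem_Icc] at hx
  rw [Finset.mem_Ioo] at hy
  exact ⟨by simpa [latticePoint] using mod_cast hx, by simpa [latticePoint] using mod_cast hy⟩

theorem convex_strip : Convex ℝ strip :=
  (convex_Icc 0 40).prod (convex_Ioo 0 42)

namespace GadgetEdge

/-- The ends of the segment that represents an edge in the strip; it is horizontal if the edge has
a terminal as an end. -/
def pt (e : GadgetEdge) (b : Bool) : ℤ × ℤ :=
  ((gadgetPos (e.ends b)).1, match e.ends b with
    | .terminal _ => (gadgetPos (e.ends !b)).2
    | .inner v => (gadgetPos (.inner v)).2)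

/-- The segment that represents an edge in the strip. -/
def segment (e : GadgetEdge) : unitInterval → ℝ × ℝ := segmentCurve (latticePoint ∘ e.pt)

theorem latticePoint_pt_mem_strip (e : GadgetEdge) (b : Bool) : latticePoint (e.pt b) ∈ strip := by
  refine latticePoint_mem_strip (gadgetPos_fst_mem _) ?_
  split
  · exact gadgetPos_snd_mem _
  · exact gadgetPos_snd_mem _

theorem segment_mem_strip (e : GadgetEdge) (t : unitInterval) : e.segment t ∈ strip :=
  segmentCurve_mem convex_strip e.latticePoint_pt_mem_strip t

theorem pt_false_fst_ne : ∀ e : GadgetEdge, (e.pt false).1 ≠ (e.pt true).1 := by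
  decide +kernel

theorem liesBeside_or_liesBeside : ∀ e f : GadgetEdge, e ≠ f →
    LiesBeside e.pt f.pt ∨ LiesBeside f.pt e.pt := by
  decide +kernel

theorem range_segment_inter_subset {e f : GadgetEdge} (hef : e ≠ f) :
    Set.range e.segment ∩ Set.range f.segment ⊆ Set.range (latticePoint ∘ e.pt) := by
  rcases e.liesBeside_or_liesBeside f hef with h | h
  · exact h.latticePoint.range_inter_subset.trans Set.inter_subset_left
  · rw [Set.inter_comm]
    exact h.latticePoint.range_inter_subset.trans Set.inter_subset_right

theorem injective_segment_fst (e : GadgetEdge) :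
    Function.Injective fun t => (e.segment t).1 := by
  have hne : ((e.pt false).1 : ℝ) ≠ (e.pt true).1 := by exact_mod_cast e.pt_false_fst_ne
  intro s t hst
  simp only [segment, segmentCurve, AffineMap.fst_lineMap] at hst
  exact Subtype.ext (AffineMap.lineMap_injective ℝ hne hst)

theorem exists_ends_eq_terminal_of_segment_fst {e : GadgetEdge} {t : unitInterval} {s : Bool}
    (h : (e.segment t).1 = stripSide s) : ∃ b, e.ends b = .terminal s := by
  by_contra! hcon
  have hside : ∀ b, (e.pt b).1 ≠ stripSide s := fun b hb =>
    hcon b (eq_terminal_of_gadgetPos_fst _ s hb)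
  have hmem : ∀ b, 0 ≤ (e.pt b).1 ∧ (e.pt b).1 ≤ 40 := fun b =>
    Finset.mem_Icc.1 (gadgetPos_fst_mem _)
  cases s
  · have hpos : ∀ b, latticePoint (e.pt b) ∈ Set.Ioi 0 ×ˢ Set.univ := fun b =>
      ⟨by simpa [latticePoint] using (hmem b).1.lt_of_ne' (hside b), trivial⟩
    have := (segmentCurve_mem ((convex_Ioi 0).prod convex_univ) hpos t).1
    exact this.ne' (by simpa [stripSide] using h)
  · have hlt : ∀ b, latticePoint (e.pt b) ∈ Set.Iio 40 ×ˢ Set.univ := fun b =>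
      ⟨by simpa [latticePoint] using mod_cast (hmem b).2.lt_of_ne (hside b), trivial⟩
    have := (segmentCurve_mem ((convex_Iio 40).prod convex_univ) hlt t).1
    exact this.ne (by simpa [stripSide] using h)

end GadgetEdge

/-! ### The drawing of the full construction -/

/-- The map of the strip to the plane that places a copy of the gadget: it shrinks the vertical
sides to points that depend only on `p` and only on `q`, respectively. -/
def drawCopy (p q : Bool) (c : Fin 7) (z : ℝ × ℝ) : ℝ × ℝ :=
  ((if p then -1 else 1) * (40 - z.1),
    z.1 * (12000 * (q.toNat + 1 : ℕ) + (42 * (c : ℕ) + z.2) * (40 - z.1)))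

theorem continuous_drawCopy (p q : Bool) (c : Fin 7) : Continuous (drawCopy p q c) := by
  unfold drawCopy
  fun_prop

theorem eq_and_eq_zero_or_eq_of_ite_neg_one_mul_eq {K : Type*} [Ring K] [LinearOrder K]
    [IsOrderedRing K] {p q : Bool} {a b : K} (ha : 0 ≤ a) (hb : 0 ≤ b)
    (h : (if p then -1 else 1) * a = (if q then -1 else 1) * b) : a = b ∧ (a = 0 ∨ p = q) := by
  cases p <;> cases q <;>
    simp only [Bool.false_eq_true, if_false, if_true, one_mul, neg_one_mul, neg_inj] at h
  · exact ⟨h, .inr rfl⟩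
  · have ha' : a = 0 := le_antisymm (h ▸ neg_nonpos.2 hb) ha
    exact ⟨by rw [ha', ← neg_eq_zero.1 (h.symm.trans ha')], .inl ha'⟩
  · have hb' : b = 0 := le_antisymm (h ▸ neg_nonpos.2 ha) hb
    have ha' : a = 0 := neg_eq_zero.1 (h.trans hb')
    exact ⟨ha'.trans hb'.symm, .inl ha'⟩
  · exact ⟨h, .inr rfl⟩

theorem natCast_eq_and_eq_of_mul_add_eq {K : Type*} [Ring K] [LinearOrder K]
    [IsStrictOrderedRing K] {m r r' : K} {k k' : ℕ} (hr : 0 ≤ r) (hrm : r < m) (hr' : 0 ≤ r')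
    (hrm' : r' < m) (h : m * k + r = m * k' + r') : k = k' ∧ r = r' := by
  have hm : 0 ≤ m := hr.trans hrm.le
  have le_of_eq {k k' : ℕ} {r r' : K} (hr : 0 ≤ r) (hrm' : r' < m)
      (h : m * k + r = m * k' + r') : k ≤ k' := by
    by_contra! hlt
    have hk : ((k' + 1 : ℕ) : K) ≤ k := Nat.cast_le.2 hlt
    refine lt_irrefl (m * k + r) ?_
    calc m * k + r = m * k' + r' := h
      _ < m * k' + m := by gcongr
      _ = m * (k' + 1 : ℕ) := by rw [Nat.cast_succ, mul_add, mul_one]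
      _ ≤ m * k := by gcongr
      _ ≤ m * k + r := le_add_of_nonneg_right hr
  obtain rfl := le_antisymm (le_of_eq hr hrm' h) (le_of_eq hr' hrm h.symm)
  exact ⟨rfl, add_left_cancel h⟩

theorem boolToNat_injective : Function.Injective Bool.toNat := by decide

theorem eq_of_drawCopy_snd_eq {q q' : Bool} {c c' : Fin 7} {x y y' : ℝ} (hx : 0 < x) (hx' : x < 40)
    (hy : y ∈ Set.Ioo 0 42) (hy' : y' ∈ Set.Ioo 0 42)
    (h : 12000 * ((q.toNat + 1 : ℕ) : ℝ) + (42 * (c : ℕ) + y) * (40 - x) =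
      12000 * (q'.toNat + 1 : ℕ) + (42 * (c' : ℕ) + y') * (40 - x)) :
    q = q' ∧ c = c' ∧ y = y' := by
  have hx0 : 0 < 40 - x := sub_pos.2 hx'
  -- the heights of the seven strips stay below `42 * 7 * 40 < 12000`
  have hmem (d : Fin 7) {w : ℝ} (hw : w ∈ Set.Ioo 0 42) :
      0 ≤ (42 * ((d : ℕ) : ℝ) + w) * (40 - x) ∧ (42 * ((d : ℕ) : ℝ) + w) * (40 - x) < 12000 := by
    have hd : ((d : ℕ) : ℝ) ≤ 6 := by exact_mod_cast Nat.le_of_lt_succ d.2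
    have hdw : 0 ≤ 42 * ((d : ℕ) : ℝ) + w := add_nonneg (by positivity) hw.1.le
    refine ⟨mul_nonneg hdw hx0.le, ?_⟩
    calc (42 * ((d : ℕ) : ℝ) + w) * (40 - x) ≤ (42 * 6 + 42) * 40 := by
          gcongr
          · exact hw.2.le
          · linarith
      _ < 12000 := by norm_num
  obtain ⟨hq, h⟩ := natCast_eq_and_eq_of_mul_add_eq (hmem c hy).1 (hmem c hy).2 (hmem c' hy').1
    (hmem c' hy').2 h
  obtain ⟨hc, h⟩ := natCast_eq_and_eq_of_mul_add_eq hy.1.le hy.2 hy'.1.le hy'.2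
    (mul_right_cancel₀ hx0.ne' h)
  exact ⟨boolToNat_injective (Nat.succ_injective hq), Fin.ext hc, h⟩

theorem drawCopy_eq {p q p' q' : Bool} {c c' : Fin 7} {z z' : ℝ × ℝ} (hz : z ∈ strip)
    (hz' : z' ∈ strip) (h : drawCopy p q c z = drawCopy p' q' c' z') :
    z.1 = z'.1 ∧ ((∃ s, z.1 = stripSide s ∧
      placeCopy p q c (.terminal s) = placeCopy p' q' c' (.terminal s)) ∨
      (p = p' ∧ q = q' ∧ c = c' ∧ z = z')) := by
  obtain ⟨x, y⟩ := z
  obtain ⟨x', y'⟩ := z'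
  obtain ⟨⟨hx0, hx40⟩, hy⟩ := hz
  obtain ⟨⟨hx0', hx40'⟩, hy'⟩ := hz'
  obtain ⟨hfst, hsnd⟩ := Prod.mk.inj h
  obtain ⟨hx, hp⟩ := eq_and_eq_zero_or_eq_of_ite_neg_one_mul_eq (sub_nonneg.2 hx40)
    (sub_nonneg.2 hx40') hfst
  obtain rfl : x = x' := sub_right_injective hx
  refine ⟨rfl, ?_⟩
  obtain rfl | hx0 := hx0.eq_or_lt'
  · obtain rfl := hp.resolve_left (by norm_num)
    exact .inl ⟨false, by simp [stripSide], rfl⟩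
  have hsnd := mul_left_cancel₀ hx0.ne' hsnd
  obtain rfl | hx40 : x = 40 ∨ x < 40 := hx40.eq_or_lt
  · have hq : q = q' := by
      simpa [boolToNat_injective.eq_iff] using hsnd
    exact .inl ⟨true, by simp [stripSide], by rw [hq]; rfl⟩
  · obtain ⟨rfl, rfl, rfl⟩ := eq_of_drawCopy_snd_eq hx0 hx40 hy hy' hsnd
    exact .inr ⟨hp.resolve_left (sub_pos.2 hx40).ne', rfl, rfl, rfl⟩

/-- The positions of the vertices of the full construction. -/
def fullPos : FullVertex → ℝ × ℝ
  | .hub e p => drawCopy p p 0 (stripSide e, 0)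
  | .copy p q c v => drawCopy p q c (latticePoint (gadgetPos (.inner v)))

theorem drawCopy_of_fst_eq (p q : Bool) (c : Fin 7) {s : Bool} {z : ℝ × ℝ}
    (h : z.1 = stripSide s) : drawCopy p q c z = fullPos (placeCopy p q c (.terminal s)) := by
  cases s <;> simp [placeCopy, fullPos, drawCopy, h, stripSide]

theorem drawCopy_gadgetPos (p q : Bool) (c : Fin 7) (a : GadgetVertex) :
    drawCopy p q c (latticePoint (gadgetPos a)) = fullPos (placeCopy p q c a) := by
  rcases a with s | v
  · exact drawCopy_of_fst_eq p q c rfl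
  · rfl

theorem drawCopy_pt (p q : Bool) (c : Fin 7) (e : GadgetEdge) (b : Bool) :
    drawCopy p q c (latticePoint (e.pt b)) = fullPos (placeCopy p q c (e.ends b)) := by
  rcases h : e.ends b with s | v
  · exact drawCopy_of_fst_eq p q c (by simp [latticePoint, GadgetEdge.pt, h, gadgetPos])
  · rw [← drawCopy_gadgetPos, GadgetEdge.pt, h]

theorem exists_placeCopy_eq : ∀ u : FullVertex, ∃ p q c a, placeCopy p q c a = u
  | .hub false p => ⟨p, p, 0, .terminal false, rfl⟩
  | .hub true q => ⟨q, q, 0, .terminal true, rfl⟩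
  | .copy p q c v => ⟨p, q, c, .inner v, rfl⟩

theorem latticePoint_gadgetPos_mem_strip (a : GadgetVertex) :
    latticePoint (gadgetPos a) ∈ strip :=
  latticePoint_mem_strip (gadgetPos_fst_mem a) (gadgetPos_snd_mem a)

theorem fullPos_injective : Function.Injective fullPos := by
  intro u v h
  obtain ⟨p, q, c, a, rfl⟩ := exists_placeCopy_eq u
  obtain ⟨p', q', c', b, rfl⟩ := exists_placeCopy_eq v
  rw [← drawCopy_gadgetPos, ← drawCopy_gadgetPos] at h
  obtain ⟨hfst, ⟨s, hs, hterminal⟩ | ⟨rfl, rfl, rfl, hab⟩⟩ :=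
    drawCopy_eq (latticePoint_gadgetPos_mem_strip a) (latticePoint_gadgetPos_mem_strip b) h
  · obtain rfl := eq_terminal_of_gadgetPos_fst a s (Int.cast_injective hs)
    obtain rfl := eq_terminal_of_gadgetPos_fst b s (Int.cast_injective (hfst.symm.trans hs))
    exact hterminal
  · rw [gadgetPos_injective (latticePoint_injective hab)]

namespace FullEdge

/-- The curves that represent the edges of the full construction. -/
def curve : FullEdge → unitInterval → ℝ × ℝ
  | hub e => segmentCurve fun b => fullPos (.hub e b)
  | copy p q c e => drawCopy p q c ∘ e.segment

theorem continuous_curve (e : FullEdge) : Continuous e.curve := by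
  rcases e with _ | ⟨p, q, c, _⟩ <;> rw [curve]
  · exact continuous_segmentCurve _
  · exact (continuous_drawCopy p q c).comp (continuous_segmentCurve _)

theorem curve_injective (e : FullEdge) : Function.Injective e.curve := by
  rcases e with _ | ⟨p, q, c, e⟩ <;> rw [curve]
  · exact segmentCurve_injective (fullPos_injective.ne (by simp))
  · exact fun s t hst =>
      e.injective_segment_fst (drawCopy_eq (e.segment_mem_strip s) (e.segment_mem_strip t) hst).1

theorem curve_zero (e : FullEdge) : e.curve 0 = fullPos (e.ends false) := by
  rcases e with _ | ⟨p, q, c, e⟩ <;> rw [curve, ends]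
  · exact segmentCurve_zero _
  · rw [← drawCopy_pt, Function.comp_apply, GadgetEdge.segment, segmentCurve_zero,
      Function.comp_apply]

theorem curve_one (e : FullEdge) : e.curve 1 = fullPos (e.ends true) := by
  rcases e with _ | ⟨p, q, c, e⟩ <;> rw [curve, ends]
  · exact segmentCurve_one _
  · rw [← drawCopy_pt, Function.comp_apply, GadgetEdge.segment, segmentCurve_one,
      Function.comp_apply]

theorem curve_mem_image_range_ends_of_fst_eq {p q : Bool} {c : Fin 7} {e : GadgetEdge}
    {t : unitInterval} {s : Bool} (h : (e.segment t).1 = stripSide s) :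
    (copy p q c e).curve t ∈ fullPos '' Set.range (copy p q c e).ends := by
  obtain ⟨b, hb⟩ := GadgetEdge.exists_ends_eq_terminal_of_segment_fst h
  refine ⟨_, ⟨b, rfl⟩, ?_⟩
  rw [ends, hb]
  exact (drawCopy_of_fst_eq p q c h).symm

theorem curve_hub_false_snd (t : unitInterval) : ((hub false).curve t).2 = 0 := by
  simp [curve, segmentCurve, AffineMap.snd_lineMap, fullPos, drawCopy, stripSide]

theorem curve_hub_true_fst (t : unitInterval) : ((hub true).curve t).1 = 0 := by
  simp [curve, segmentCurve, AffineMap.fst_lineMap, fullPos, drawCopy, stripSide]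

theorem curve_hub_true_snd_pos (t : unitInterval) : 0 < ((hub true).curve t).2 := by
  refine (segmentCurve_mem (convex_univ.prod (convex_Ioi 0)) (fun b => ⟨trivial, ?_⟩) t).2
  simp only [fullPos, drawCopy, stripSide, if_true, Int.cast_ofNat, sub_self, mul_zero, add_zero,
    Set.mem_Ioi]
  positivity

theorem segment_fst_eq_of_curve_hub_eq {r p q : Bool} {c : Fin 7} {e : GadgetEdge}
    {s t : unitInterval} (h : (hub r).curve s = (copy p q c e).curve t) :
    (e.segment t).1 = stripSide r := by
  obtain ⟨⟨-, hx40⟩, hy0, -⟩ := e.segment_mem_strip t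
  cases r
  · have hsnd : (drawCopy p q c (e.segment t)).2 = 0 :=
      (congrArg Prod.snd h).symm.trans (curve_hub_false_snd s)
    have hpos : 0 ≤ (42 * ((c : ℕ) : ℝ) + (e.segment t).2) * (40 - (e.segment t).1) :=
      mul_nonneg (by positivity) (sub_nonneg.2 hx40)
    simpa [stripSide] using (mul_eq_zero.1 hsnd).resolve_right
      (add_pos_of_pos_of_nonneg (by positivity) hpos).ne'
  · have hfst : (drawCopy p q c (e.segment t)).1 = 0 :=
      (congrArg Prod.fst h).symm.trans (curve_hub_true_fst s)
    have := (mul_eq_zero.1 hfst).resolve_left (by cases p <;> norm_num)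
    simpa [stripSide] using (sub_eq_zero.1 this).symm

theorem disjoint_range_curve_hub : Disjoint (Set.range (hub false).curve)
    (Set.range (hub true).curve) := by
  rw [Set.disjoint_left]
  rintro _ ⟨s, rfl⟩ ⟨t, hst⟩
  exact (curve_hub_true_snd_pos t).ne' (hst ▸ curve_hub_false_snd s)

theorem range_curve_inter_subset {e f : FullEdge} (hef : e ≠ f) :
    Set.range e.curve ∩ Set.range f.curve ⊆ fullPos '' Set.range e.ends := by
  rintro _ ⟨⟨s, rfl⟩, ⟨t, hst⟩⟩
  rcases e with r | ⟨p, q, c, e⟩ <;> rcases f with r' | ⟨p', q', c', f⟩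
  · cases r <;> cases r'
    · exact (hef rfl).elim
    · exact (disjoint_range_curve_hub.ne_of_mem ⟨s, rfl⟩ ⟨t, rfl⟩ hst.symm).elim
    · exact (disjoint_range_curve_hub.ne_of_mem ⟨t, rfl⟩ ⟨s, rfl⟩ hst).elim
    · exact (hef rfl).elim
  · have := drawCopy_of_fst_eq p' q' c' (segment_fst_eq_of_curve_hub_eq hst.symm)
    rw [placeCopy_terminal] at this
    exact ⟨_, ⟨_, rfl⟩, this.symm.trans hst⟩
  · exact curve_mem_image_range_ends_of_fst_eq (segment_fst_eq_of_curve_hub_eq hst)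
  · obtain ⟨-, ⟨r, hr, -⟩ | ⟨rfl, rfl, rfl, hseg⟩⟩ :=
      drawCopy_eq (e.segment_mem_strip s) (f.segment_mem_strip t) hst.symm
    · exact curve_mem_image_range_ends_of_fst_eq hr
    · obtain ⟨b, hb⟩ := GadgetEdge.range_segment_inter_subset (fun h => hef (by rw [h]))
        ⟨⟨s, rfl⟩, ⟨t, hseg.symm⟩⟩
      exact ⟨_, ⟨b, rfl⟩, by rw [ends, ← drawCopy_pt]; exact congrArg _ hb⟩

theorem exists_ends_eq (v : FullVertex) : ∃ (e : FullEdge) (b : Bool), e.ends b = v := by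
  have hgadget : ∀ a, ∃ (e : GadgetEdge) (b : Bool), e.ends b = a := by
    decide +kernel
  obtain ⟨p, q, c, a, rfl⟩ := exists_placeCopy_eq v
  obtain ⟨e, b, rfl⟩ := hgadget a
  exact ⟨copy p q c e, b, rfl⟩

theorem fullPos_ends_mem_range_curve (e : FullEdge) (b : Bool) :
    fullPos (e.ends b) ∈ Set.range e.curve := by
  cases b
  · exact ⟨0, e.curve_zero⟩
  · exact ⟨1, e.curve_one⟩

theorem mem_range_ends_of_fullPos_mem_range_curve {e : FullEdge} {v : FullVertex}
    (h : fullPos v ∈ Set.range e.curve) : v ∈ Set.range e.ends := by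
  obtain ⟨f, b, rfl⟩ := exists_ends_eq v
  obtain rfl | hne := eq_or_ne e f
  · exact ⟨b, rfl⟩
  · exact fullPos_injective.mem_set_image.1
      (range_curve_inter_subset hne ⟨h, f.fullPos_ends_mem_range_curve b⟩)

end FullEdge

theorem isPlanarGraph_fullGraph : IsPlanarGraph fullGraph :=
  isPlanarGraph_of_curves fullPos_injective fullGraph_adj_iff.1 FullEdge.continuous_curve
    FullEdge.curve_injective FullEdge.curve_zero FullEdge.curve_one
    (fun _ _ => FullEdge.mem_range_ends_of_fullPos_mem_range_curve)
    (fun _ _ => FullEdge.range_curve_inter_subset)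

theorem isPlanarGraph_reducedGraph : IsPlanarGraph reducedGraph :=
  isPlanarGraph_fullGraph.comap (SimpleGraph.Embedding.induce _).toCopy

theorem mainTheorem4 :
    (∀ A : Set GadgetVertex, IsDefectiveColoring forcingGadget 0 3 A →
      ∃ (s : Bool) (v : GadgetVertex), forcingGadget.Adj (.terminal s) v ∧ v ∉ A) ∧
    InClassC fullGraph ∧
    ¬ IsDefectiveColorable fullGraph 0 3 ∧
    (∀ A : Set {v : GadgetVertex // ¬ v.IsGreen}, IsDefectiveColoring reducedGadget 0 2 A →
      ∃ (s : Bool) (v : {v : GadgetVertex // ¬ v.IsGreen}),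
        forcingGadget.Adj (.terminal s) v ∧ v ∉ A) ∧
    IsPlanarGraph reducedGraph ∧
    reducedGraph.egirth = 7 ∧
    Nat.card {v : FullVertex // ¬ v.IsGreen} = 684 ∧
    ¬ IsDefectiveColorable reducedGraph 0 2 := by
  exact ⟨forcesNonzeroNeighbor_forcingGadget,
    ⟨isPlanarGraph_fullGraph, cycleGraph_free_fullGraph (by norm_num) (by norm_num) (by norm_num),
      cycleGraph_free_fullGraph (by norm_num) (by norm_num) (by norm_num),
      cycleGraph_free_fullGraph (by norm_num) (by norm_num) (by norm_num)⟩,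
    not_isDefectiveColorable_fullGraph, forcesNonzeroNeighbor_reducedGadget,
    isPlanarGraph_reducedGraph, egirth_reducedGraph, card_reducedGraph,
    not_isDefectiveColorable_reducedGraph⟩
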